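/- Let $p$ be a prime number, let $\mathscr L_G$ be the language of rings together with a unary predicate $G$, and let $\mathrm{ACF}_G$ be the $\mathscr L_G$-theory whose models are the pairs $(K,G)$ with $K$ an algebraically closed field of characteristic $p$ and $G$ an additive subgroup of $K$. Let $\mathrm{ACFG}$ be the model companion of $\mathrm{ACF}_G$. For subsets $A,B$ of a field put $A\cdot B=\{ab\mid a\in A,\,b\in B\}$ and $A+B=\{a+b\mid a\in A,\,b\in B\}$. **Proposition.** Let $(K,G)$ be a model of $\mathrm{ACFG}$. Then: 1. $K=G\cdot G=G\cdot(K\setminus G)$ and $(K\setminus G)\cdot(K\setminus G)=K\setminus\{0\}$. 2. $G$ is stably embedded in $(K,G)$: for every $n$, every subset of $G^n$ that is definable in $(K,G)$ with parameters from $K$ is definable in $(K,G)$ with parameters from $G$. 3. For every $a\in K\setminus\mathbb F_p$, $K=G+aG=(K\setminus G)+aG$; and for every polynomial $P\in K[X]\setminus(K+\mathbb F_p\cdot X)$, $K=G+P(G)$, where $P(G)=\{P(g)\mid g\in G\}$. -/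

import Mathlib

open FirstOrder FirstOrder.Language
open scoped Pointwise

universe u v w

/-- The only non-logical symbol of `predLang`: a unary relation symbol. -/
inductive PredRel : ℕ → Type
  | mem : PredRel 1

/-- The language with one unary predicate and nothing else. -/
def predLang : FirstOrder.Language.{0, 0} where
  Functions := fun _ => Empty
  Relations := PredRel

/-- The language `L_G`: the language of rings together with a unary predicate `G`. -/
abbrev ringPredLang : FirstOrder.Language.{0, 0} := Language.ring.sum predLang

/-- The predicate symbol `G` of `L_G`. -/
abbrev predSymb : ringPredLang.Relations 1 := Sum.inr PredRel.mem

/-- The atomic formula `G(t)`. -/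
abbrev inPred {α : Type} {n : ℕ} (t : ringPredLang.Term (α ⊕ Fin n)) :
    ringPredLang.BoundedFormula α n :=
  predSymb.boundedFormula₁ t

/-- The constant `0` as a term of `L_G`. -/
def zeroTerm {α : Type} : ringPredLang.Term α :=
  Constants.term (L := ringPredLang) (Sum.inl Ring.zeroFunc)

/-- The term `s + t` of `L_G`. -/
def addTerm {α : Type} (s t : ringPredLang.Term α) : ringPredLang.Term α :=
  Functions.apply₂ (L := ringPredLang) (Sum.inl Ring.addFunc) s t

/-- The term `-t` of `L_G`. -/
def negTerm {α : Type} (t : ringPredLang.Term α) : ringPredLang.Term α :=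
  Functions.apply₁ (L := ringPredLang) (Sum.inl Ring.negFunc) t

/-- The axioms saying that `G` is an additive subgroup: `G(0)`,
`∀ x y, G(x) → G(y) → G(x + y)` and `∀ x, G(x) → G(-x)`. -/
def subgroupAxioms : ringPredLang.Theory :=
  {inPred zeroTerm,
   ∀' ∀' (inPred &0 ⟹ (inPred &1 ⟹ inPred (addTerm &0 &1))),
   ∀' (inPred &0 ⟹ inPred (negTerm &0))}

/-- The `L_G`-theory of algebraically closed fields of characteristic `p` in which `G` is a
predicate for an additive subgroup. -/
noncomputable def theoryACFsubG (p : ℕ) : ringPredLang.Theory :=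
  (LHom.sumInl : Language.ring →ᴸ ringPredLang).onTheory (Theory.ACF p) ∪ subgroupAxioms

/-- `T'` is a model companion of `T`: every model of `T` embeds in a model of `T'`, every model of
`T'` embeds in a model of `T`, and `T'` is model complete, that is, every embedding between models
of `T'` is elementary.  By the Löwenheim-Skolem theorem it is enough to consider models in the
universe of the language. -/
structure IsModelCompanion {L : FirstOrder.Language.{u, v}} (T' T : L.Theory) : Prop where
  embeds_of_base : ∀ M : Theory.ModelType.{u, v, max u v} T,
    ∃ N : Theory.ModelType.{u, v, max u v} T', Nonempty (M ↪[L] N)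
  embeds_in_base : ∀ N : Theory.ModelType.{u, v, max u v} T',
    ∃ M : Theory.ModelType.{u, v, max u v} T, Nonempty (N ↪[L] M)
  modelComplete : ∀ (M N : Theory.ModelType.{u, v, max u v} T') (f : M ↪[L] N)
    (n : ℕ) (φ : L.Formula (Fin n)) (x : Fin n → M), φ.Realize (f ∘ x) ↔ φ.Realize x

/-- The model companion of `T`.  A theory has at most one model companion up to logical equivalence;
this is its deductively closed version, consisting of all the sentences which the model companion
implies. -/
def modelCompanion {L : FirstOrder.Language.{u, v}} (T : L.Theory) : L.Theory :=
  {σ | ∀ T' : L.Theory, IsModelCompanion T' T → T' ⊨ᵇ σ}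

/-- The theory `ACFG` in characteristic `p`: the model companion of the theory of algebraically
closed fields of characteristic `p` with a predicate for an additive subgroup. -/
noncomputable def theoryACFG (p : ℕ) : ringPredLang.Theory := modelCompanion (theoryACFsubG p)

/-- The set `G` as an interpretation of the unary predicate. -/
@[reducible] def predStructure {K : Type w} (G : Set K) : predLang.Structure K where
  funMap := fun f => Empty.elim f
  RelMap := fun r x => match r, x with
    | PredRel.mem, x => x 0 ∈ G

/-- The `L_G`-structure `(K, G)`, for a field `K` and a subset `G` of `K`. -/
@[reducible] def pairStructure (K : Type w) [Field K] (G : Set K) : ringPredLang.Structure K :=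
  @Language.sumStructure Language.ring predLang K
    (Ring.compatibleRingOfRing K).toStructure (predStructure G)

/-- The `L_G`-structure `(K, G)` is a model of the theory `T`. -/
def PairModels (K : Type w) [Field K] (G : Set K) (T : ringPredLang.Theory) : Prop :=
  letI := pairStructure K G
  K ⊨ T

/-- A subset `X` of an `L`-structure `M` is stably embedded if every subset of `X ^ n` which is
definable in `M` with parameters from `M` is definable in `M` with parameters from `X`. -/
def IsStablyEmbedded (L : FirstOrder.Language.{u, v}) {M : Type w} [L.Structure M] (X : Set M) : Prop :=
  ∀ (n : ℕ) (D : Set (Fin n → M)), (∀ x ∈ D, ∀ i, x i ∈ X) →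
    (Set.univ : Set M).Definable L D → X.Definable L D

/-- `G` is stably embedded in the `L_G`-structure `(K, G)`. -/
def PairStablyEmbedded (K : Type w) [Field K] (G : Set K) : Prop :=
  letI := pairStructure K G
  IsStablyEmbedded ringPredLang G

/-! Everything follows from one transfer principle. Let `N` be a model of a model companion `T'` of
`T`. Embed `N` in a model of `T`, extend that so that an existential formula becomes true, and embed
the result in a model of `T'`. Existential formulas go up along embeddings, and model completeness
brings this one back down to `N`. The argument applies to an arbitrary model companion, so the
existence of one plays no role.

For pairs, it therefore suffices to solve one equation in two unknowns, with prescribed membership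
in the subgroup, in some extension of a given pair `(M, H)`. Take `t` transcendental over `M` and
enlarge `H` by chosen elements that are integrally independent modulo `M`, so that the trace on `M`
remains `H`. For products the solution is `(t, x / t)`; for sums it is `(-P(t), t)`. Comparing
coefficients in `M[X]` decides which of these elements may be put in the subgroup and which stay out
of it. Side conditions on the parameters (nonzero, outside the prime field) enter as the premise `r
≠ 0` of the formula.

Stable embeddedness is then a consequence of `G * G = K`: every parameter is a product of two
parameters from `G`. -/

/-! ### Transfer of existential formulas to the model companion -/

/-- An existential property which, for every tuple of a model of `T`, becomes true in some
extension that is again a model of `T`, holds for all tuples of all models of the model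
companion. -/
theorem iAlls_mem_modelCompanion {L : FirstOrder.Language.{u, v}} {T : L.Theory} {n : ℕ}
    {φ : L.Formula (Fin n)} (hφ : BoundedFormula.IsExistential φ)
    (h : ∀ (M : Theory.ModelType.{u, v, max u v} T) (x : Fin n → M),
      ∃ (M' : Theory.ModelType.{u, v, max u v} T) (f : M ↪[L] M'), φ.Realize (f ∘ x)) :
    Formula.iAlls (α := Empty) (Fin n) (φ.relabel Sum.inr) ∈ modelCompanion T := by
  intro T' hT'
  rw [Theory.models_sentence_iff]
  intro N
  rw [Sentence.Realize, Formula.realize_iAlls]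
  intro x
  rw [Formula.realize_relabel]
  change φ.Realize x
  obtain ⟨M, ⟨f⟩⟩ := hT'.embeds_in_base N
  obtain ⟨M', g, hg⟩ := h M (f ∘ x)
  obtain ⟨N', ⟨k⟩⟩ := hT'.embeds_of_base M'
  refine (hT'.modelComplete N N' ((k.comp g).comp f) n φ x).1 ?_
  have := hφ.realize_embedding k hg
  rwa [Unique.eq_default (k ∘ default)] at this

/-- Passing through the universal closure, a sentence of the theory, lets `K` lie in any universe
although `h` only inspects models in the universe of the language. -/
theorem realize_of_modelCompanion {L : FirstOrder.Language.{u, v}} {T : L.Theory} {n : ℕ}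
    {φ : L.Formula (Fin n)} (hφ : BoundedFormula.IsExistential φ)
    (h : ∀ (M : Theory.ModelType.{u, v, max u v} T) (x : Fin n → M),
      ∃ (M' : Theory.ModelType.{u, v, max u v} T) (f : M ↪[L] M'), φ.Realize (f ∘ x))
    {K : Type w} [L.Structure K] (hK : K ⊨ modelCompanion T) (x : Fin n → K) :
    φ.Realize x := by
  have := Theory.realize_sentence_of_mem (M := K) (modelCompanion T) (iAlls_mem_modelCompanion hφ h)
  rw [Sentence.Realize, Formula.realize_iAlls] at this
  simpa using this x

/-! ### Pairs as models of the base theory -/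

/-- A ring homomorphism pulling back `H` to `G` is an embedding of pairs. -/
noncomputable def pairEmbedding {K : Type u} {M : Type v} [Field K] [Field M] (f : K →+* M)
    (G : Set K) (H : Set M) (hGH : ∀ x, f x ∈ H ↔ x ∈ G) :
    letI := pairStructure K G
    letI := pairStructure M H
    K ↪[ringPredLang] M :=
  letI := pairStructure K G
  letI := pairStructure M H
  { toFun := f
    inj' := f.injective
    map_fun' := by
      rintro n (c | c) x
      · cases c
        · exact map_add f _ _
        · exact map_mul f _ _
        · exact map_neg f _
        · exact map_zero f
        · exact map_one f
      · exact c.elim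
    map_rel' := by
      rintro n (r | r) x
      · exact Empty.elim r
      · cases r
        exact hGH _ }

theorem pairModels_theoryACFsubG {p : ℕ} {M : Type u} [Field M] [IsAlgClosed M] [CharP M p]
    (H : AddSubgroup M) : PairModels M (H : Set M) (theoryACFsubG p) := by
  let _ := Ring.compatibleRingOfRing M
  let _ := predStructure (H : Set M)
  let _ := pairStructure M (H : Set M)
  refine Theory.model_union_iff.2 ⟨?_, ?_⟩
  · refine (LHom.onTheory_model (LHom.sumInl : Language.ring →ᴸ ringPredLang) _).2 ?_
    infer_instance
  · simp only [subgroupAxioms, Theory.model_iff, Set.mem_insert_iff, Set.mem_singleton_iff]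
    rintro φ (rfl | rfl | rfl)
    · rw [Sentence.Realize, Formula.Realize, BoundedFormula.realize_rel₁]
      exact H.zero_mem
    · simp only [Sentence.Realize, Formula.Realize, BoundedFormula.realize_all,
        BoundedFormula.realize_imp, BoundedFormula.realize_rel₁]
      exact fun a b ha hb => H.add_mem ha hb
    · simp only [Sentence.Realize, Formula.Realize, BoundedFormula.realize_all,
        BoundedFormula.realize_imp, BoundedFormula.realize_rel₁]
      exact fun a ha => H.neg_mem ha

theorem realize_addTerm {M : Type u} [ringPredLang.Structure M] {α : Type}
    (s t : ringPredLang.Term α) (x : α → M) : (addTerm s t).realize x =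
      Structure.funMap (L := ringPredLang) (Sum.inl Ring.addFunc : ringPredLang.Functions 2)
        ![s.realize x, t.realize x] :=
  Term.realize_functions_apply₂ (L := ringPredLang)

theorem realize_negTerm {M : Type u} [ringPredLang.Structure M] {α : Type}
    (t : ringPredLang.Term α) (x : α → M) : (negTerm t).realize x =
      Structure.funMap (L := ringPredLang) (Sum.inl Ring.negFunc : ringPredLang.Functions 1)
        ![t.realize x] :=
  Term.realize_functions_apply₁ (L := ringPredLang)

/-- The term `s * t` of `L_G`. -/
def mulTerm {α : Type v} (s t : ringPredLang.Term α) : ringPredLang.Term α :=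
  Functions.apply₂ (L := ringPredLang) (Sum.inl Ring.mulFunc) s t

theorem realize_mulTerm {M : Type u} [ringPredLang.Structure M] {α : Type v}
    (s t : ringPredLang.Term α) (x : α → M) : (mulTerm s t).realize x =
      Structure.funMap (L := ringPredLang) (Sum.inl Ring.mulFunc : ringPredLang.Functions 2)
        ![s.realize x, t.realize x] :=
  Term.realize_functions_apply₂ (L := ringPredLang)

/-- Every model of `theoryACFsubG p` is a pair `(M, H)`. -/
theorem exists_eq_pairStructure {p : ℕ} (M : Type u) [S : ringPredLang.Structure M]
    [hM : M ⊨ theoryACFsubG p] :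
    ∃ (_ : Field M) (H : AddSubgroup M), IsAlgClosed M ∧ CharP M p ∧
      S = pairStructure M (H : Set M) := by
  let _ : Language.ring.Structure M := (LHom.sumInl : Language.ring →ᴸ ringPredLang).reduct M
  have hE : (LHom.sumInl : Language.ring →ᴸ ringPredLang).IsExpansionOn M :=
    ⟨fun _ _ => rfl, fun _ _ => rfl⟩
  have hU := Theory.model_union_iff.1 hM
  have hACF : M ⊨ Theory.ACF p := (LHom.onTheory_model _ _).1 hU.1
  let _ := Field.fieldOfModelACF p M
  have := Field.modelField_of_modelACF p M
  let _ := Field.compatibleRingOfModelField M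
  have h0 : Structure.RelMap predSymb ![(0 : M)] := by
    have := hU.2.realize_of_mem (inPred zeroTerm) (by simp [subgroupAxioms])
    rw [Sentence.Realize, Formula.Realize, BoundedFormula.realize_rel₁] at this
    convert this using 3
    exact (Ring.CompatibleRing.funMap_zero _).symm
  have hadd : ∀ a b : M, Structure.RelMap predSymb ![a] → Structure.RelMap predSymb ![b] →
      Structure.RelMap predSymb ![a + b] := by
    have := hU.2.realize_of_mem (∀' ∀' (inPred &0 ⟹ (inPred &1 ⟹ inPred (addTerm &0 &1))))
      (by simp [subgroupAxioms])
    simp only [Sentence.Realize, Formula.Realize, BoundedFormula.realize_all,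
        BoundedFormula.realize_imp, BoundedFormula.realize_rel₁] at this
    intro a b ha hb
    convert this a b ha hb using 3
    refine Eq.trans ?_ (realize_addTerm _ _ _).symm
    exact (Ring.CompatibleRing.funMap_add ![a, b]).symm
  have hneg : ∀ a : M, Structure.RelMap predSymb ![a] → Structure.RelMap predSymb ![-a] := by
    have := hU.2.realize_of_mem (∀' (inPred &0 ⟹ inPred (negTerm &0)))
      (by simp [subgroupAxioms])
    simp only [Sentence.Realize, Formula.Realize, BoundedFormula.realize_all,
        BoundedFormula.realize_imp, BoundedFormula.realize_rel₁] at this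
    intro a ha
    convert this a ha using 3
    refine Eq.trans ?_ (realize_negTerm _ _).symm
    exact (Ring.CompatibleRing.funMap_neg ![a]).symm
  refine ⟨inferInstance, ⟨⟨⟨{x | Structure.RelMap predSymb ![x]}, fun {a b} => hadd a b⟩, h0⟩,
    fun {a} => hneg a⟩, Field.isAlgClosed_of_model_ACF p M,
    Field.charP_of_model_fieldOfChar p M, ?_⟩
  refine Structure.ext ?_ ?_
  · funext n c x
    rcases c with c | c
    · cases c
      · exact Ring.CompatibleRing.funMap_add x
      · exact Ring.CompatibleRing.funMap_mul x
      · exact Ring.CompatibleRing.funMap_neg x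
      · exact Ring.CompatibleRing.funMap_zero x
      · exact Ring.CompatibleRing.funMap_one x
    · exact c.elim
  · funext n r x
    rcases r with r | r
    · exact Empty.elim r
    · cases r
      change Structure.RelMap predSymb x = Structure.RelMap predSymb ![x 0]
      congr 1
      funext i
      fin_cases i
      rfl

/-! ### Polynomial equations with prescribed membership in the subgroup -/

/-- The literal `φ` or `¬ φ`, according to the sign `ε`. -/
def literal {L : FirstOrder.Language.{u, v}} {α : Type w} {n : ℕ} (ε : Bool)
    (φ : L.BoundedFormula α n) : L.BoundedFormula α n :=
  if ε then φ else ∼φ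

theorem isQF_literal {L : FirstOrder.Language.{u, v}} {α : Type w} {n : ℕ} (ε : Bool)
    {φ : L.BoundedFormula α n} (h : φ.IsQF) : (literal ε φ).IsQF := by
  cases ε
  · exact h.not
  · exact h

theorem realize_literal {L : FirstOrder.Language.{u, v}} {α : Type w} {n : ℕ} (ε : Bool)
    {φ : L.BoundedFormula α n} {M : Type*} [L.Structure M] (v : α → M) (x : Fin n → M) :
    (literal ε φ).Realize v x ↔ (φ.Realize v x ↔ ε = true) := by
  cases ε <;> simp [literal]

/-- The atomic formula `f = 0` of `L_G`, for an integral polynomial `f`. -/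
noncomputable def polyEqZero {α : Type} {n : ℕ} (f : FreeCommRing (α ⊕ Fin n)) :
    ringPredLang.BoundedFormula α n :=
  (LHom.sumInl : Language.ring →ᴸ ringPredLang).onTerm (Ring.termOfFreeCommRing f) ='
    (LHom.sumInl : Language.ring →ᴸ ringPredLang).onTerm 0

theorem realize_polyEqZero {α : Type} {n : ℕ} (f : FreeCommRing (α ⊕ Fin n)) {M : Type u}
    [Field M] (H : Set M) (v : α → M) (x : Fin n → M) :
    letI := pairStructure M H
    (polyEqZero f).Realize v x ↔ FreeCommRing.lift (Sum.elim v x) f = 0 := by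
  let _ := Ring.compatibleRingOfRing M
  let _ := predStructure H
  let _ := pairStructure M H
  rw [polyEqZero, BoundedFormula.realize_bdEqual, LHom.realize_onTerm, LHom.realize_onTerm,
    Ring.realize_termOfFreeCommRing, Ring.realize_zero]

/-- The quantifier free formula saying that `r ≠ 0` implies that `f = 0`, where membership in
`G` of the last two variables is prescribed by the signs `ε` and `δ`. -/
noncomputable def signedSolution {n : ℕ} (r f : FreeCommRing (Fin n ⊕ Fin 2)) (ε δ : Bool) :
    ringPredLang.BoundedFormula (Fin n) 2 :=
  ∼(polyEqZero r) ⟹ (polyEqZero f ⊓ (literal ε (inPred &0) ⊓ literal δ (inPred &1)))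

theorem isQF_signedSolution {n : ℕ} (r f : FreeCommRing (Fin n ⊕ Fin 2)) (ε δ : Bool) :
    (signedSolution r f ε δ).IsQF := by
  have h (g : FreeCommRing (Fin n ⊕ Fin 2)) : (polyEqZero g).IsQF :=
    (BoundedFormula.IsAtomic.equal _ _).isQF
  exact (h r).not.imp ((h f).inf ((isQF_literal _ (BoundedFormula.IsAtomic.rel _ _).isQF).inf
    (isQF_literal _ (BoundedFormula.IsAtomic.rel _ _).isQF)))

theorem realize_ex_signedSolution {n : ℕ} (r f : FreeCommRing (Fin n ⊕ Fin 2)) (ε δ : Bool)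
    {M : Type u} [Field M] (H : Set M) (x : Fin n → M) :
    letI := pairStructure M H
    Formula.Realize (∃' ∃' (signedSolution r f ε δ) : ringPredLang.Formula (Fin n)) x ↔
      ∃ a b : M, FreeCommRing.lift (Sum.elim x ![a, b]) r ≠ 0 →
        FreeCommRing.lift (Sum.elim x ![a, b]) f = 0 ∧
          (a ∈ H ↔ ε = true) ∧ (b ∈ H ↔ δ = true) := by
  let _ := pairStructure M H
  have h (a b : M) : (Fin.snoc (Fin.snoc default a : Fin 1 → M) b : Fin 2 → M) = ![a, b] := by
    funext i; fin_cases i <;> rfl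
  simp only [Formula.Realize, BoundedFormula.realize_ex, signedSolution,
    BoundedFormula.realize_imp, BoundedFormula.realize_not, BoundedFormula.realize_inf,
    realize_literal, BoundedFormula.realize_rel₁, h, realize_polyEqZero]
  rfl

/-- If a polynomial system with prescribed membership in the subgroup can always be solved in an
extension of pairs, then it can be solved in every model of `ACFG`. -/
theorem exists_solution_of_theoryACFG {p : ℕ} {n : ℕ} (r f : FreeCommRing (Fin n ⊕ Fin 2))
    (ε δ : Bool)
    (h : ∀ (M : Type) [Field M] [IsAlgClosed M] [CharP M p] (H : AddSubgroup M) (x : Fin n → M),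
      ∃ (M' : Type) (_ : Field M') (_ : IsAlgClosed M') (g : M →+* M') (H' : AddSubgroup M')
        (a b : M'), (∀ y, g y ∈ H' ↔ y ∈ H) ∧
          (FreeCommRing.lift (Sum.elim (g ∘ x) ![a, b]) r ≠ 0 →
            FreeCommRing.lift (Sum.elim (g ∘ x) ![a, b]) f = 0 ∧
            (a ∈ H' ↔ ε = true) ∧ (b ∈ H' ↔ δ = true)))
    {K : Type u} [Field K] {G : Set K} (hKG : PairModels K G (theoryACFG p)) (x : Fin n → K) :
    ∃ a b : K, FreeCommRing.lift (Sum.elim x ![a, b]) r ≠ 0 →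
      FreeCommRing.lift (Sum.elim x ![a, b]) f = 0 ∧ (a ∈ G ↔ ε = true) ∧ (b ∈ G ↔ δ = true) := by
  let _ := pairStructure K G
  refine (realize_ex_signedSolution r f ε δ G x).1 (realize_of_modelCompanion
    (T := theoryACFsubG p) (.ex (.ex (.of_isQF (isQF_signedSolution r f ε δ)))) ?_ hKG x)
  rintro ⟨M, S, hM⟩ x
  obtain ⟨_, H, _, _, rfl⟩ := exists_eq_pairStructure (p := p) M
  obtain ⟨M', _, _, g, H', a, b, hg, hab⟩ := h M H x
  have : CharP M' p := charP_of_injective_ringHom g.injective p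
  let _ := pairStructure M' (H' : Set M')
  have : M' ⊨ theoryACFsubG p := pairModels_theoryACFsubG H'
  exact ⟨.of _ M', pairEmbedding g H H' hg,
    (realize_ex_signedSolution r f ε δ (H' : Set M') (g ∘ x)).2 ⟨a, b, hab⟩⟩

/-! ### Stable embeddedness -/

/-- If every element is a product of two elements of `X`, then `X` is stably embedded. -/
theorem isStablyEmbedded_of_forall_eq_mul {K : Type u} [Field K] {G : Set K}
    (h : G * G = Set.univ) : PairStablyEmbedded K G := by
  let _ := pairStructure K G
  intro n D _ hD
  rw [Set.definable_iff_exists_formula_sum] at hD ⊢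
  obtain ⟨φ, rfl⟩ := hD
  have hmul (k : K) : ∃ a b : G, (a : K) * b = k := by
    obtain ⟨a, ha, b, hb, hk⟩ := Set.mem_mul.1 (h ▸ Set.mem_univ k)
    exact ⟨⟨a, ha⟩, ⟨b, hb⟩, hk⟩
  choose a b hab using hmul
  -- Each parameter `k` is replaced by the term `a k * b k`, whose two parameters lie in `G`.
  refine ⟨φ.subst (Sum.elim (fun k => mulTerm (Term.var (Sum.inl (a k))) (Term.var (Sum.inl (b k))))
    (fun i => Term.var (Sum.inr i))), ?_⟩
  ext v
  simp only [Set.mem_ofPred_eq]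
  rw [Formula.Realize, Formula.Realize, BoundedFormula.realize_subst]
  refine iff_of_eq (congrArg (fun w => BoundedFormula.Realize φ w default) ?_)
  funext i
  rcases i with k | i
  · refine Eq.trans ?_ (realize_mulTerm _ _ _).symm
    exact (hab k).symm
  · rfl

/-! ### Extending a pair by a transcendental element -/

/-- A field embeds in an algebraically closed field containing a transcendental element. -/
theorem exists_isAlgClosed_polynomial_injective (M : Type u) [Field M] :
    ∃ (M' : Type u) (_ : Field M') (_ : IsAlgClosed M') (θ : Polynomial M →+* M'),
      Function.Injective θ :=
  ⟨AlgebraicClosure (FractionRing (Polynomial M)), inferInstance, inferInstance,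
    (algebraMap (FractionRing (Polynomial M)) _).comp (algebraMap (Polynomial M) _),
    (RingHom.injective (algebraMap (FractionRing (Polynomial M)) _)).comp
      (IsFractionRing.injective (Polynomial M) (FractionRing (Polynomial M)))⟩

/-- Extending a subgroup by two elements which generate no new element of the small field. -/
theorem exists_addSubgroup_extension {M : Type u} {M' : Type v} [Field M] [Field M']
    (g : M →+* M') (H : AddSubgroup M) (a b : M')
    (h : ∀ (m n : ℤ) (c : M), m • a + n • b = g c → c = 0) :
    ∃ H' : AddSubgroup M', (∀ y, g y ∈ H' ↔ y ∈ H) ∧ a ∈ H' ∧ b ∈ H' ∧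
      ∀ z ∈ H', ∃ (c : M) (m n : ℤ), z = g c + (m • a + n • b) := by
  have key : ∀ z ∈ H.map (g : M →+ M') ⊔ AddSubgroup.closure {a, b},
      ∃ c ∈ H, ∃ m n : ℤ, z = g c + (m • a + n • b) := by
    intro z hz
    obtain ⟨_, ⟨c, hc, rfl⟩, s, hs, rfl⟩ := AddSubgroup.mem_sup.1 hz
    obtain ⟨m, n, rfl⟩ := AddSubgroup.mem_closure_pair.1 hs
    exact ⟨c, hc, m, n, rfl⟩
  refine ⟨H.map (g : M →+ M') ⊔ AddSubgroup.closure {a, b}, fun y => ⟨fun hy => ?_, fun hy => ?_⟩,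
    ?_, ?_, fun z hz => ?_⟩
  · obtain ⟨c, hc, m, n, hz⟩ := key _ hy
    -- A new element lying in the small field equals its `H`-part `c`, by the independence
    -- hypothesis.
    have := h m n (y - c) (by rw [map_sub, hz]; ring)
    rwa [sub_eq_zero.1 this]
  · exact AddSubgroup.mem_sup_left ⟨y, hy, rfl⟩
  · exact AddSubgroup.mem_sup_right (AddSubgroup.subset_closure (by simp))
  · exact AddSubgroup.mem_sup_right (AddSubgroup.subset_closure (by simp))
  · obtain ⟨c, _, m, n, hz⟩ := key z hz
    exact ⟨c, m, n, hz⟩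

/-! ### The equations and the prime field -/

/-- The integral polynomial in `x, a, b` given by `a * b - x`. -/
noncomputable def productEquation : FreeCommRing (Fin 1 ⊕ Fin 2) :=
  .of (.inr 0) * .of (.inr 1) - .of (.inl 0)

theorem lift_productEquation {R : Type u} [CommRing R] (x : Fin 1 → R) (a b : R) :
    FreeCommRing.lift (Sum.elim x ![a, b]) productEquation = a * b - x 0 := by
  simp [productEquation]

/-- The integral polynomial in `c₀, …, cₙ₋₁, a, b` given by `a + ∑ cᵢ * b ^ i`. -/
noncomputable def sumEquation (n : ℕ) : FreeCommRing (Fin n ⊕ Fin 2) :=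
  .of (.inr 0) + ∑ i : Fin n, .of (.inl i) * .of (.inr 1) ^ (i : ℕ)

theorem lift_sumEquation {R : Type u} [CommRing R] {n : ℕ} (c : Fin n → R) (a b : R) :
    FreeCommRing.lift (Sum.elim c ![a, b]) (sumEquation n) = a + ∑ i, c i * b ^ (i : ℕ) := by
  simp [sumEquation]

/-- The integral polynomial `∏ (c - j)`, over `j < p`, whose roots in characteristic `p` are the
elements of the prime field. -/
noncomputable def primeFieldEquation {α : Type} (p : ℕ) (i : α) : FreeCommRing α :=
  ∏ j ∈ Finset.range p, (.of i - (j : FreeCommRing α))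

theorem lift_primeFieldEquation_ne_zero {R : Type u} [Field R] {α : Type} (p : ℕ) (i : α)
    (x : α → R) : FreeCommRing.lift x (primeFieldEquation p i) ≠ 0 ↔
      ∀ j < p, x i ≠ (j : R) := by
  simp [primeFieldEquation, Finset.prod_eq_zero_iff, sub_eq_zero]

/-- The quotient `m / n` can be formed in `ZMod p`, whose image in `M` is the prime field. -/
theorem exists_natCast_eq_of_intCast_mul_eq {p : ℕ} (hp : p.Prime) {M : Type u} [Field M]
    [CharP M p] {c : M} {m n : ℤ} (hn : (n : M) ≠ 0) (h : (n : M) * c = m) :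
    ∃ j < p, c = (j : M) := by
  have := Fact.mk hp
  refine ⟨((m : ZMod p) / (n : ZMod p)).val, ZMod.val_lt _, ?_⟩
  have h1 := map_natCast (ZMod.castHom (dvd_refl p) M) ((m : ZMod p) / (n : ZMod p)).val
  rw [ZMod.natCast_zmod_val, map_div₀, map_intCast, map_intCast] at h1
  rw [← h1, eq_div_iff hn, mul_comm, h]

/-! ### Products of elements of `G` and of its complement -/

section

variable {p : ℕ} {K : Type u} [Field K] {G : Set K}

theorem zero_mem_of_theoryACFG (hKG : PairModels K G (theoryACFG p)) : (0 : K) ∈ G := by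
  -- The equation is `a = 0` with `a` required in `G`; the premise `1 ≠ 0` always holds and `b` is a
  -- dummy, so every pair solves it in itself.
  obtain ⟨a, b, h⟩ := exists_solution_of_theoryACFG (n := 0) 1 (.of (.inr 0)) true true
    (fun M _ _ _ H x => ⟨M, inferInstance, inferInstance, RingHom.id M, H, 0, 0,
      fun _ => Iff.rfl, fun _ => by simp⟩) hKG default
  obtain ⟨h0, ha, -⟩ := h (by simp)
  have h0 : a = 0 := by simpa using h0
  exact h0 ▸ ha.2 rfl

theorem exists_mul_eq_of_theoryACFG (hKG : PairModels K G (theoryACFG p)) (ε δ : Bool)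
    (h : ∀ (M : Type) [Field M] [IsAlgClosed M] [CharP M p] (H : AddSubgroup M) (x : M), x ≠ 0 →
      ∃ (M' : Type) (_ : Field M') (_ : IsAlgClosed M') (g : M →+* M') (H' : AddSubgroup M')
        (a b : M'), (∀ y, g y ∈ H' ↔ y ∈ H) ∧ a * b = g x ∧
            (a ∈ H' ↔ ε = true) ∧ (b ∈ H' ↔ δ = true)) {x : K} (hx : x ≠ 0) :
    ∃ a b : K, a * b = x ∧ (a ∈ G ↔ ε = true) ∧ (b ∈ G ↔ δ = true) := by
  obtain ⟨a, b, hab⟩ := exists_solution_of_theoryACFG (.of (.inl 0)) productEquation ε δ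
    (fun M _ _ _ H x => by
      -- For `x 0 = 0` the premise of the formula fails, and the pair itself serves as the
      -- extension.
      by_cases hx : x 0 = 0
      · exact ⟨M, inferInstance, inferInstance, RingHom.id M, H, 0, 0, fun _ => Iff.rfl,
          fun h => (h (by simpa using hx)).elim⟩
      · obtain ⟨M', i, j, g, H', a, b, hg, hab, hb⟩ := h M H (x 0) hx
        refine ⟨M', i, j, g, H', a, b, hg, fun _ => ⟨?_, hb⟩⟩
        rw [lift_productEquation, Function.comp_apply, hab, sub_self]) hKG (fun _ => x)
  rw [lift_productEquation] at hab
  obtain ⟨h1, h2⟩ := hab (by simpa using hx)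
  exact ⟨a, b, sub_eq_zero.1 h1, h2⟩

/-- Multiplying by `t = θ X` gives the polynomial identity `m X ^ 2 + d x = c X`, whose coefficients
can be compared because `θ` is injective. -/
theorem div_transcendental_relation {M : Type u} {M' : Type v} [Field M] [Field M']
    {θ : Polynomial M →+* M'} (hθ : Function.Injective θ) {x c d m : M}
    (h : θ (.C m) * θ .X + θ (.C d) * (θ (.C x) / θ .X) = θ (.C c)) :
    m = 0 ∧ d * x = 0 ∧ c = 0 := by
  have ht : θ .X ≠ 0 := (map_ne_zero_iff θ hθ).2 Polynomial.X_ne_zero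
  have h1 : θ (.C m * .X ^ 2 + .C (d * x)) = θ (.C c * .X) := by
    rw [map_add, map_mul, map_mul, map_pow, map_mul, map_mul, ← h]
    field_simp
  have h2 := hθ h1
  refine ⟨?_, ?_, ?_⟩
  · simpa [Polynomial.coeff_X, Polynomial.coeff_C] using congrArg (Polynomial.coeff · 2) h2
  · simpa [Polynomial.coeff_C, Polynomial.coeff_X] using congrArg (Polynomial.coeff · 0) h2
  · simpa [Polynomial.coeff_C, Polynomial.coeff_X, Polynomial.coeff_X_pow, eq_comm]
      using congrArg (Polynomial.coeff · 1) h2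

theorem exists_mem_mul_mem_eq (hKG : PairModels K G (theoryACFG p)) {x : K} (hx : x ≠ 0) :
    ∃ a ∈ G, ∃ b ∈ G, a * b = x := by
  obtain ⟨a, b, hab, ha, hb⟩ := exists_mul_eq_of_theoryACFG hKG true true
    (fun M _ _ _ H x hx => by
      obtain ⟨M', i, j, θ, hθ⟩ := exists_isAlgClosed_polynomial_injective M
      have ht : θ .X ≠ 0 := (map_ne_zero_iff θ hθ).2 Polynomial.X_ne_zero
      obtain ⟨H', hH, ha, hb, -⟩ := exists_addSubgroup_extension (θ.comp Polynomial.C) H (θ .X)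
        (θ (.C x) / θ .X) (fun m n c h =>
          (div_transcendental_relation hθ (m := m) (d := n) (by simpa [zsmul_eq_mul] using h)).2.2)
      exact ⟨M', i, j, _, H', _, _, hH, mul_div_cancel₀ _ ht, by simpa using ha,
        by simpa using hb⟩) hx
  exact ⟨a, ha.2 rfl, b, hb.2 rfl, hab⟩

theorem exists_mem_mul_notMem_eq (hKG : PairModels K G (theoryACFG p)) {x : K} (hx : x ≠ 0) :
    ∃ a ∈ G, ∃ b ∉ G, a * b = x := by
  obtain ⟨a, b, hab, ha, hb⟩ := exists_mul_eq_of_theoryACFG hKG true false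
    (fun M _ _ _ H x hx => by
      obtain ⟨M', i, j, θ, hθ⟩ := exists_isAlgClosed_polynomial_injective M
      have ht : θ .X ≠ 0 := (map_ne_zero_iff θ hθ).2 Polynomial.X_ne_zero
      obtain ⟨H', hH, ha, -, h⟩ := exists_addSubgroup_extension (θ.comp Polynomial.C) H (θ .X)
        0 (fun m n c h =>
          (div_transcendental_relation hθ (x := 0) (m := m) (d := n)
            (by simpa [zsmul_eq_mul] using h)).2.2)
      refine ⟨M', i, j, _, H', _, θ (.C x) / θ .X, hH, mul_div_cancel₀ _ ht, by simpa using ha, ?_⟩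
      simp only [Bool.false_eq_true, iff_false]
      intro hb
      obtain ⟨c, m, n, h⟩ := h _ hb
      have := (div_transcendental_relation hθ (x := x) (m := -m) (d := 1) (c := c) (by
        rw [h]; simp [zsmul_eq_mul])).2.1
      exact hx (by simpa using this)) hx
  exact ⟨a, ha.2 rfl, b, by simpa using hb, hab⟩

theorem exists_notMem_mul_notMem_eq (hKG : PairModels K G (theoryACFG p)) {x : K} (hx : x ≠ 0) :
    ∃ a ∉ G, ∃ b ∉ G, a * b = x := by
  obtain ⟨a, b, hab, ha, hb⟩ := exists_mul_eq_of_theoryACFG hKG false false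
    (fun M _ _ _ H x hx => by
      obtain ⟨M', i, j, θ, hθ⟩ := exists_isAlgClosed_polynomial_injective M
      have ht : θ .X ≠ 0 := (map_ne_zero_iff θ hθ).2 Polynomial.X_ne_zero
      -- Nothing is adjoined: `H'` lies in the image of `M`, which contains neither `t` nor `x / t`.
      obtain ⟨H', hH, -, -, h⟩ := exists_addSubgroup_extension (θ.comp Polynomial.C) H 0 0
        (fun m n c h => by
          have h : θ (.C c) = 0 := by simpa using h.symm
          simpa using hθ (h.trans (map_zero θ).symm))
      refine ⟨M', i, j, _, H', θ .X, θ (.C x) / θ .X, hH, mul_div_cancel₀ _ ht, ?_, ?_⟩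
      · simp only [Bool.false_eq_true, iff_false]
        intro hb
        obtain ⟨c, m, n, h⟩ := h _ hb
        have := (div_transcendental_relation hθ (x := 0) (m := 1) (d := 0) (c := c) (by
          rw [h]; simp)).1
        exact one_ne_zero this
      · simp only [Bool.false_eq_true, iff_false]
        intro hb
        obtain ⟨c, m, n, h⟩ := h _ hb
        have := (div_transcendental_relation hθ (x := x) (m := 0) (d := 1) (c := c) (by
          rw [h]; simp)).2.1
        exact hx (by simpa using this)) hx
  exact ⟨a, by simpa using ha, b, by simpa using hb, hab⟩

/-! ### Sums of `G` with polynomial images of `G` -/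

/-- The polynomial with coefficients `c`. -/
noncomputable def polyOfCoeffs {R : Type u} [CommRing R] {n : ℕ} (c : Fin n → R) : Polynomial R :=
  ∑ i : Fin n, .C (c i) * .X ^ (i : ℕ)

theorem coeff_polyOfCoeffs {R : Type u} [CommRing R] {n : ℕ} (c : Fin n → R) (i : Fin n) :
    (polyOfCoeffs c).coeff i = c i := by
  simp [polyOfCoeffs, Polynomial.finsetSum_coeff, Polynomial.coeff_X_pow, Fin.val_inj]

theorem lift_map_inl {R : Type u} [CommRing R] {n : ℕ} (r : FreeCommRing (Fin n)) (c : Fin n → R)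
    (y : Fin 2 → R) :
    FreeCommRing.lift (Sum.elim c y) (FreeCommRing.map Sum.inl r) = FreeCommRing.lift c r := by
  have : (FreeCommRing.lift (Sum.elim c y)).comp (FreeCommRing.map Sum.inl) =
    FreeCommRing.lift c := FreeCommRing.hom_ext fun i => by simp
  exact congrArg (· r) this

theorem lift_comp {R : Type u} {S : Type v} [CommRing R] [CommRing S] (g : R →+* S) {n : ℕ}
    (r : FreeCommRing (Fin n)) (c : Fin n → R) :
    FreeCommRing.lift (g ∘ c) r = g (FreeCommRing.lift c r) := by
  have : FreeCommRing.lift (g ∘ c) = g.comp (FreeCommRing.lift c) :=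
    FreeCommRing.hom_ext fun i => by simp
  exact congrArg (· r) this

/-- With `b = t` and `a = -P(t)` the equation holds automatically, so only the membership of these
two elements has to be arranged. -/
theorem exists_add_polynomial_eq_zero_of_extension (hKG : PairModels K G (theoryACFG p)) {n : ℕ}
    (r : FreeCommRing (Fin n)) (ε δ : Bool)
    (h : ∀ (M : Type) [Field M] [IsAlgClosed M] [CharP M p] (H : AddSubgroup M) (c : Fin n → M),
      FreeCommRing.lift c r ≠ 0 →
      ∃ (M' : Type) (_ : Field M') (_ : IsAlgClosed M') (θ : Polynomial M →+* M')
        (H' : AddSubgroup M'), (∀ y, θ (.C y) ∈ H' ↔ y ∈ H) ∧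
          (-θ (polyOfCoeffs c) ∈ H' ↔ ε = true) ∧ (θ .X ∈ H' ↔ δ = true))
    (c : Fin n → K) (hc : FreeCommRing.lift c r ≠ 0) :
    ∃ a b : K, a + ∑ i, c i * b ^ (i : ℕ) = 0 ∧ (a ∈ G ↔ ε = true) ∧ (b ∈ G ↔ δ = true) := by
  obtain ⟨a, b, hab⟩ := exists_solution_of_theoryACFG (FreeCommRing.map Sum.inl r)
    (sumEquation n) ε δ (fun M _ _ _ H c => by
      by_cases hc : FreeCommRing.lift c r = 0
      · exact ⟨M, inferInstance, inferInstance, RingHom.id M, H, 0, 0, fun _ => Iff.rfl,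
          fun h => (h (by rw [lift_map_inl, lift_comp, hc, map_zero])).elim⟩
      · obtain ⟨M', i, j, θ, H', hH, hab⟩ := h M H c hc
        refine ⟨M', i, j, θ.comp Polynomial.C, H', _, _, hH, fun _ => ⟨?_, hab⟩⟩
        rw [lift_sumEquation]
        simp [polyOfCoeffs]) hKG c
  rw [lift_sumEquation, lift_map_inl] at hab
  exact ⟨a, b, hab hc⟩

/-- Both `t` and `-P(t)` are adjoined to `H`. By `hr`, a relation `l X + m P = d` reduces to `l X =
d`, whose constant coefficient gives `d = 0`; hence no new element of `M` appears. -/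
theorem exists_mem_add_polynomial_eq_zero (hKG : PairModels K G (theoryACFG p)) {n : ℕ}
    (r : FreeCommRing (Fin n))
    (hr : ∀ (M : Type) [Field M] [CharP M p] (c : Fin n → M), FreeCommRing.lift c r ≠ 0 →
      ∀ (l m : ℤ) (d : M), (.C (l : M) * .X + .C (m : M) * polyOfCoeffs c) = Polynomial.C d →
        (m : M) = 0)
    (c : Fin n → K) (hc : FreeCommRing.lift c r ≠ 0) :
    ∃ a ∈ G, ∃ b ∈ G, a + ∑ i, c i * b ^ (i : ℕ) = 0 := by
  obtain ⟨a, b, hab, ha, hb⟩ := exists_add_polynomial_eq_zero_of_extension hKG r true true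
    (fun M _ _ _ H c hc => by
      obtain ⟨M', i, j, θ, hθ⟩ := exists_isAlgClosed_polynomial_injective M
      obtain ⟨H', hH, ha, hb, -⟩ := exists_addSubgroup_extension (θ.comp Polynomial.C) H (θ .X)
        (-θ (polyOfCoeffs c)) (fun l m d h => by
          have h1 : .C (l : M) * .X + .C ((-m : ℤ) : M) * polyOfCoeffs c = Polynomial.C d := by
            apply hθ
            rw [RingHom.comp_apply] at h
            rw [← h]
            simp [zsmul_eq_mul]
          have hm := hr M c hc l (-m) d h1
          rw [hm, map_zero, zero_mul, add_zero] at h1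
          simpa using (congrArg (Polynomial.coeff · 0) h1).symm)
      exact ⟨M', i, j, θ, H', hH, by simpa using hb, by simpa using ha⟩) c hc
  exact ⟨a, ha.2 rfl, b, hb.2 rfl, hab⟩

/-- The coefficient of `X` in a relation `l X + m P = d` gives `m c₁ = -l`, so `m ≠ 0` would place
`c₁` in the prime field. -/
theorem exists_mem_add_polynomial_eq_zero_of_notMem_primeField
    (hp : p.Prime) (hKG : PairModels K G (theoryACFG p)) {n : ℕ} (c : Fin (n + 2) → K)
    (hc : ∀ j < p, c 1 ≠ (j : K)) : ∃ a ∈ G, ∃ b ∈ G, a + ∑ i, c i * b ^ (i : ℕ) = 0 := by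
  refine exists_mem_add_polynomial_eq_zero hKG (primeFieldEquation p 1) ?_ c
    ((lift_primeFieldEquation_ne_zero p 1 c).2 hc)
  intro M _ _ c hc l m d h
  by_contra hm
  have h1 := congrArg (Polynomial.coeff · 1) h
  have h2 : (polyOfCoeffs c).coeff 1 = c 1 := coeff_polyOfCoeffs c 1
  simp only [Polynomial.coeff_add, Polynomial.coeff_C_mul, Polynomial.coeff_X_one, h2,
    Polynomial.coeff_C, one_ne_zero, if_false, mul_one] at h1
  obtain ⟨j, hj, h3⟩ := exists_natCast_eq_of_intCast_mul_eq hp (c := c 1) (m := -l) hm (by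
    push_cast; linear_combination h1)
  exact (lift_primeFieldEquation_ne_zero p 1 c).1 hc j hj h3

/-- In degree `k ≥ 2` the relation `l X + m P = d` reads `m cₖ = 0`. -/
theorem exists_mem_add_polynomial_eq_zero_of_coeff_ne_zero (hKG : PairModels K G (theoryACFG p))
    {n : ℕ} (c : Fin n → K) (k : Fin n) (hk : 2 ≤ (k : ℕ)) (hc : c k ≠ 0) :
    ∃ a ∈ G, ∃ b ∈ G, a + ∑ i, c i * b ^ (i : ℕ) = 0 := by
  refine exists_mem_add_polynomial_eq_zero hKG (.of k) ?_ c (by simpa using hc)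
  intro M _ _ c hc l m d h
  have h1 := congrArg (Polynomial.coeff · k) h
  simp only [Polynomial.coeff_add, Polynomial.coeff_C_mul, coeff_polyOfCoeffs, Polynomial.coeff_X,
    Polynomial.coeff_C, show ¬ (1 = (k : ℕ)) by lia, show ¬ ((k : ℕ) = 0) by lia, if_false, mul_zero,
    zero_add] at h1
  exact (mul_eq_zero.1 h1).resolve_right (by simpa using hc)

/-- Only `t` is adjoined. If `-P(t)` were in `M + ℤ t`, then `c₁` would be the image of an integer.
-/
theorem exists_notMem_add_linear_eq_zero (hp : p.Prime) (hKG : PairModels K G (theoryACFG p))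
    (c : Fin 2 → K) (hc : ∀ j < p, c 1 ≠ (j : K)) :
    ∃ a ∉ G, ∃ b ∈ G, a + ∑ i, c i * b ^ (i : ℕ) = 0 := by
  obtain ⟨a, b, hab, ha, hb⟩ := exists_add_polynomial_eq_zero_of_extension hKG
    (primeFieldEquation p 1) false true
    (fun M _ _ _ H c hc => by
      obtain ⟨M', i, j, θ, hθ⟩ := exists_isAlgClosed_polynomial_injective M
      obtain ⟨H', hH, ha, -, h⟩ := exists_addSubgroup_extension (θ.comp Polynomial.C) H (θ .X) 0
        (fun m n d h => by
          have h1 : .C (m : M) * .X = Polynomial.C d := by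
            apply hθ
            rw [RingHom.comp_apply] at h
            rw [← h]
            simp [zsmul_eq_mul]
          simpa using (congrArg (Polynomial.coeff · 0) h1).symm)
      refine ⟨M', i, j, θ, H', hH, ?_, by simpa using ha⟩
      simp only [Bool.false_eq_true, iff_false]
      intro hb
      obtain ⟨d, m, n, h⟩ := h _ hb
      have h1 : -polyOfCoeffs c = .C d + .C (m : M) * .X := by
        apply hθ
        rw [RingHom.comp_apply] at h
        rw [map_neg, h]
        simp [zsmul_eq_mul]
      have h2 : (polyOfCoeffs c).coeff 1 = c 1 := coeff_polyOfCoeffs c 1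
      have h3 := congrArg (Polynomial.coeff · 1) h1
      simp only [Polynomial.coeff_neg, h2, Polynomial.coeff_add, Polynomial.coeff_C, one_ne_zero,
        if_false, Polynomial.coeff_C_mul, Polynomial.coeff_X_one, mul_one, zero_add] at h3
      obtain ⟨j, hj, h3⟩ := exists_natCast_eq_of_intCast_mul_eq (c := c 1) hp (m := -m) (n := 1)
        (by simp) (by push_cast; linear_combination -h3)
      exact (lift_primeFieldEquation_ne_zero p 1 c).1 hc j hj h3)
    c ((lift_primeFieldEquation_ne_zero p 1 c).2 hc)
  exact ⟨a, by simpa using ha, b, hb.2 rfl, hab⟩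

theorem exists_mem_add_eval_eq (hp : p.Prime) (hKG : PairModels K G (theoryACFG p))
    {P : Polynomial K} (hP : ¬ ∃ c : K, ∃ l ∈ (⊥ : Subfield K), P = .C c + .C l * .X) (x : K) :
    ∃ a ∈ G, ∃ b ∈ G, a + P.eval b = x := by
  -- The target `x` is absorbed into the constant coefficient. Length `natDegree + 2` ensures that
  -- index `1` exists even when `P` is constant.
  let c : Fin (P.natDegree + 2) → K := fun i => (P - .C x).coeff i
  have hcoeff (i : Fin (P.natDegree + 2)) (hi : (i : ℕ) ≠ 0) : c i = P.coeff i := by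
    simp only [c, Polynomial.coeff_sub, Polynomial.coeff_C, if_neg hi, sub_zero]
  have heval (b : K) : ∑ i, c i * b ^ (i : ℕ) = P.eval b - x := by
    have : (P - .C x).natDegree < P.natDegree + 2 := by
      rw [Polynomial.natDegree_sub_C]; lia
    rw [Fin.sum_univ_eq_sum_range (fun i => (P - .C x).coeff i * b ^ i),
      ← Polynomial.eval_eq_sum_range' this, Polynomial.eval_sub, Polynomial.eval_C]
  suffices h : ∃ a ∈ G, ∃ b ∈ G, a + ∑ i, c i * b ^ (i : ℕ) = 0 by
    obtain ⟨a, ha, b, hb, h⟩ := h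
    rw [heval] at h
    exact ⟨a, ha, b, hb, by linear_combination h⟩
  by_cases h1 : ∀ j < p, c 1 ≠ (j : K)
  · exact exists_mem_add_polynomial_eq_zero_of_notMem_primeField hp hKG c h1
  by_cases h2 : ∃ k : Fin (P.natDegree + 2), 2 ≤ (k : ℕ) ∧ c k ≠ 0
  · obtain ⟨k, hk, hc⟩ := h2
    exact exists_mem_add_polynomial_eq_zero_of_coeff_ne_zero hKG c k hk hc
  push Not at h1 h2
  obtain ⟨j, -, hj⟩ := h1
  have h3 : P.coeff 1 = j := (hcoeff 1 (by simp)).symm.trans hj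
  -- With linear coefficient in the prime field and no higher terms, `P` would be of the excluded
  -- form.
  refine (hP ⟨P.coeff 0, j, natCast_mem _ j, ?_⟩).elim
  ext i
  match i with
  | 0 => simp
  | 1 => simp [h3]
  | i + 2 =>
    have : P.coeff (i + 2) = 0 := by
      by_cases hi : i + 2 < P.natDegree + 2
      · rw [← h2 ⟨i + 2, hi⟩ (by simp), hcoeff _ (by simp)]
      · exact Polynomial.coeff_eq_zero_of_natDegree_lt (by lia)
    simp [this]

theorem exists_notMem_add_mul_eq (hp : p.Prime) (hKG : PairModels K G (theoryACFG p))
    {a : K} (ha : a ∉ (⊥ : Subfield K)) (x : K) : ∃ g ∉ G, ∃ h ∈ G, g + a * h = x := by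
  obtain ⟨g, hg, h, hh, he⟩ := exists_notMem_add_linear_eq_zero hp hKG ![-x, a]
    (fun j _ hj => ha (by rw [show a = (j : K) from hj]; exact natCast_mem _ j))
  refine ⟨g, hg, h, hh, ?_⟩
  simp [Fin.sum_univ_two] at he
  linear_combination he

end

/-! ### The proposition -/

theorem mainTheorem9 (p : ℕ) (hp : p.Prime) {K : Type u} [Field K] (G : Set K)
    (hKG : PairModels K G (theoryACFG p)) :
    (G * G = Set.univ ∧ G * Gᶜ = Set.univ ∧ Gᶜ * Gᶜ = {x : K | x ≠ 0}) ∧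
    PairStablyEmbedded K G ∧
    (∀ a : K, a ∉ (⊥ : Subfield K) →
      G + a • G = Set.univ ∧ Gᶜ + a • G = Set.univ) ∧
    (∀ P : Polynomial K,
      (¬ ∃ c : K, ∃ l ∈ (⊥ : Subfield K),
        P = Polynomial.C c + Polynomial.C l * Polynomial.X) →
      G + (fun x => P.eval x) '' G = Set.univ) := by
  have h0 := zero_mem_of_theoryACFG hKG
  have hGG : G * G = Set.univ := by
    refine Set.eq_univ_of_forall fun x => Set.mem_mul.2 ?_
    rcases eq_or_ne x 0 with rfl | hx
    · exact ⟨0, h0, 0, h0, zero_mul 0⟩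
    · exact exists_mem_mul_mem_eq hKG hx
  have hpoly (P : Polynomial K) (hP : ¬ ∃ c : K, ∃ l ∈ (⊥ : Subfield K),
      P = Polynomial.C c + Polynomial.C l * Polynomial.X) :
      G + (fun x => P.eval x) '' G = Set.univ := by
    refine Set.eq_univ_of_forall fun x => ?_
    obtain ⟨a, ha, b, hb, h⟩ := exists_mem_add_eval_eq hp hKG hP x
    exact Set.mem_add.2 ⟨a, ha, _, ⟨b, hb, rfl⟩, h⟩
  refine ⟨⟨hGG, ?_, ?_⟩, isStablyEmbedded_of_forall_eq_mul hGG, fun a ha => ⟨?_, ?_⟩, hpoly⟩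
  · refine Set.eq_univ_of_forall fun x => Set.mem_mul.2 ?_
    rcases eq_or_ne x 0 with rfl | hx
    · obtain ⟨b, hb, -⟩ := exists_notMem_mul_notMem_eq hKG (one_ne_zero : (1 : K) ≠ 0)
      exact ⟨0, h0, b, hb, zero_mul b⟩
    · exact exists_mem_mul_notMem_eq hKG hx
  · ext x
    refine ⟨?_, fun hx => Set.mem_mul.2 (exists_notMem_mul_notMem_eq hKG hx)⟩
    rintro ⟨a, ha, b, hb, rfl⟩
    exact mul_ne_zero (fun h => ha (h ▸ h0)) (fun h => hb (h ▸ h0))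
  -- This is the polynomial case for `P = a X`, whose linear coefficient is outside the prime field.
  · refine (congrArg (G + ·) ?_).trans (hpoly (.C a * .X) ?_)
    · simp [← Set.image_smul]
    · rintro ⟨c, l, hl, h⟩
      have := congrArg (Polynomial.coeff · 1) h
      simp [Polynomial.coeff_C] at this
      exact ha (this ▸ hl)
  · refine Set.eq_univ_of_forall fun x => ?_
    obtain ⟨g, hg, h, hh, he⟩ := exists_notMem_add_mul_eq hp hKG ha x
    exact Set.mem_add.2 ⟨g, hg, _, Set.smul_mem_smul_set hh, he⟩
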